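/- Let $V$ be a complex vector space of finite dimension $k$, let $\nu$ be a partition with at most $k$ parts, and let $\mu$ be a partition obtained from $\nu$ by removing one cell. For a partition $\lambda$ let $S_\lambda V^*$ be the $GL(V)$-module obtained by applying the Schur functor $S_\lambda$ to $V^*$ (the image of a Young symmetrizer of $\lambda$ acting on $(V^*)^{\otimes|\lambda|}$). Let $T\colon S_\nu V^*\to V^*\otimes S_\mu V^*$ be a nonzero $GL(V)$-equivariant map (equivalently, a nonzero $GL(V)$-invariant tensor in $V^*\otimes S_\mu V^*\otimes S_\nu V$), let $P\colon S_\mu V^*\otimes V^*\to S_\nu V^*$ be a nonzero $GL(V)$-equivariant map (the projection, unique up to scale), and let $$T'\colon S_\mu V^*\otimes S_\nu V^*\xrightarrow{\ \mathrm{id}\otimes T\ } S_\mu V^*\otimes V^*\otimes S_\mu V^*\xrightarrow{\ P\otimes\mathrm{id}\ } S_\nu V^*\otimes S_\mu V^*$$ be the corresponding Young flattening. Let $\pi$ be a partition with at most $k$ parts and $M\ge 0$ an integer. If the isotypic component of type $S_\pi V^*$ occurs with multiplicity $M$ (that is, is isomorphic to $(S_\pi V^*)^{\oplus M}$) both in $S_\mu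 V^*\otimes S_\nu V^*$ and in $S_\mu V^*\otimes V^*\otimes S_\mu V^*$, then the isotypic component of type $S_\pi V^*$ occurs with multiplicity $M$ in the image of $T'$. -/

import Mathlib

open scoped TensorProduct

noncomputable section

namespace YoungFlattening

open Representation

/-- The standard representation of `GL(V)` on `V`. -/
def stdRep (V : Type*) [AddCommGroup V] [Module ℂ V] :
    Representation ℂ (LinearMap.GeneralLinearGroup ℂ V) V :=
  Units.coeHom (Module.End ℂ V)

section Schur

variable {G W : Type*} [Group G] [AddCommGroup W] [Module ℂ W]

/-- The tensor power of a representation, with tensor factors indexed by `ι`: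
`g` acts diagonally on `W^{⊗ ι}`. -/
def tensorPowerRep (ρ : Representation ℂ G W) (ι : Type*) :
    Representation ℂ G (⨂[ℂ] _ : ι, W) where
  toFun g := PiTensorProduct.map fun _ => ρ g
  map_one' := by
    rw [map_one]
    exact PiTensorProduct.map_one
  map_mul' g h := by
    rw [map_mul]
    exact PiTensorProduct.map_mul _ _

/-- The permutations of the cells of a Young diagram preserving every row
(a cell is a pair `(row, column)`). -/
def rowPerms (lam : YoungDiagram) : Finset (Equiv.Perm lam.cells) :=
  Finset.univ.filter fun p => ∀ c : lam.cells, (p c).1.1 = c.1.1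

/-- The permutations of the cells of a Young diagram preserving every column. -/
def colPerms (lam : YoungDiagram) : Finset (Equiv.Perm lam.cells) :=
  Finset.univ.filter fun p => ∀ c : lam.cells, (p c).1.2 = c.1.2

/-- The Young symmetrizer of `lam`, acting on the tensor power `W^{⊗ |lam|}` whose factors are
indexed by the cells of `lam`: antisymmetrize along the columns, then symmetrize along the rows. -/
def youngSymmetrizer (W : Type*) [AddCommGroup W] [Module ℂ W] (lam : YoungDiagram) :
    Module.End ℂ (⨂[ℂ] _ : lam.cells, W) :=
  (∑ p ∈ rowPerms lam, (PiTensorProduct.reindex ℂ (fun _ => W) p).toLinearMap) ∘ₗ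
    (∑ q ∈ colPerms lam, ((Equiv.Perm.sign q : ℤ) : ℂ) •
      (PiTensorProduct.reindex ℂ (fun _ => W) q).toLinearMap)

theorem map_comp_youngSymmetrizer (f : W →ₗ[ℂ] W) (lam : YoungDiagram) :
    PiTensorProduct.map (fun _ => f) ∘ₗ youngSymmetrizer W lam =
      youngSymmetrizer W lam ∘ₗ PiTensorProduct.map (fun _ => f) := by
  ext1
  ext x
  simp [youngSymmetrizer]

theorem tensorPowerRep_mem_range (ρ : Representation ℂ G W) (lam : YoungDiagram) (g : G) :
    LinearMap.range (youngSymmetrizer W lam) ≤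
      (LinearMap.range (youngSymmetrizer W lam)).comap (tensorPowerRep ρ lam.cells g) := by
  rintro _ ⟨x, rfl⟩
  exact ⟨tensorPowerRep ρ lam.cells g x,
    (LinearMap.congr_fun (map_comp_youngSymmetrizer (ρ g) lam) x).symm⟩

/-- The Schur functor `S_lam` applied to a vector space `W`: the image of the Young symmetrizer
of `lam` acting on `W^{⊗ |lam|}`. -/
def SchurModule (lam : YoungDiagram) (W : Type*) [AddCommGroup W] [Module ℂ W] : Type _ :=
  LinearMap.range (youngSymmetrizer W lam)

instance (lam : YoungDiagram) : AddCommGroup (SchurModule lam W) :=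
  inferInstanceAs (AddCommGroup (LinearMap.range (youngSymmetrizer W lam)))

instance (lam : YoungDiagram) : Module ℂ (SchurModule lam W) :=
  inferInstanceAs (Module ℂ (LinearMap.range (youngSymmetrizer W lam)))

/-- The representation `S_lam W` obtained by applying the Schur functor to a representation `W`:
`g` acts by the restriction of its diagonal action on `W^{⊗ |lam|}`. -/
def schurRep (lam : YoungDiagram) (ρ : Representation ℂ G W) :
    Representation ℂ G (SchurModule lam W) :=
  (tensorPowerRep ρ lam.cells).subrepresentation (LinearMap.range (youngSymmetrizer W lam))
    (tensorPowerRep_mem_range ρ lam)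

end Schur

/-- The `GL(V)`-representation `S_lam V*`. -/
abbrev schurDual (lam : YoungDiagram) (V : Type*) [AddCommGroup V] [Module ℂ V] :
    Representation ℂ (LinearMap.GeneralLinearGroup ℂ V) (SchurModule lam (Module.Dual ℂ V)) :=
  schurRep lam (stdRep V).dual

/-- The Young flattening of `T : S_ν V* → V* ⊗ S_μ V*` with respect to the map
`P : S_α V* ⊗ V* → S_β V*`: the composition
`S_α V* ⊗ S_ν V* → S_α V* ⊗ V* ⊗ S_μ V* → S_β V* ⊗ S_μ V*` of `id ⊗ T` and `P ⊗ id`. -/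
def youngFlattening {V : Type*} [AddCommGroup V] [Module ℂ V] {α β μ ν : YoungDiagram}
    (T : IntertwiningMap (schurDual ν V) ((stdRep V).dual.tprod (schurDual μ V)))
    (P : IntertwiningMap ((schurDual α V).tprod (stdRep V).dual) (schurDual β V)) :
    IntertwiningMap ((schurDual α V).tprod (schurDual ν V))
      ((schurDual β V).tprod (schurDual μ V)) :=
  (P.rTensor (schurDual μ V)).comp
    ((Representation.TensorProduct.assoc (schurDual α V) (stdRep V).dual
      (schurDual μ V)).symm.toIntertwiningMap.comp (T.lTensor (schurDual α V)))

/-- The isotypic component of `ρ` of type `σ` (the sum of all subrepresentations of `ρ`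
isomorphic to `σ`) is isomorphic to a direct sum of `M` copies of `σ`. -/
def HasMultiplicity {G W S : Type*} [Group G] [AddCommGroup W] [Module ℂ W]
    [AddCommGroup S] [Module ℂ S] (ρ : Representation ℂ G W) (σ : Representation ℂ G S)
    (M : ℕ) : Prop :=
  Nonempty (isotypicComponent (MonoidAlgebra ℂ G) ρ.asModule σ.asModule
    ≃ₗ[MonoidAlgebra ℂ G] (Fin M → σ.asModule))

end YoungFlattening

end

/-! Write `T'` as `D → E → F` with `D = S_μ ⊗ S_ν`, `E = S_μ ⊗ V* ⊗ S_μ`, `F = S_ν ⊗ S_μ ≅ D`.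
Irreducibility of `S_ν V*` makes `T` injective and `P` surjective, and tensoring preserves this.
Equal finite multiplicity forces the injection `D → E` to carry the `π`-component of `D` onto that
of `E`; since `E` is semisimple, the surjection `E → F` carries it onto that of `F`. So the image of
`T'` contains the whole `π`-component of `F`, which is that of `D`
(`nonempty_isotypicComponent_range_equiv`).

The representation theory comes from half of Schur–Weyl duality, `mem_span_tensorPowerRep`:
operators commuting with the permutations are combinations of group operators. With `c A c ⊆ ℂ c`
for the Young symmetrizer `c` in the group algebra `A`, this gives irreducibility
(`isIrreducible_schurRep`); with Maschke's theorem it gives semisimplicity of tensor powers, hence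
of `E`. -/

noncomputable section

namespace YoungFlattening

open Representation

/-! ### Polarization and density of invertible endomorphisms -/

section Polarization

variable {ι E F : Type*} [Fintype ι] [AddCommGroup E] [Module ℂ E] [AddCommGroup F] [Module ℂ F]

/-- Polarization: the symmetrization of a multilinear map is a combination of its values on the
diagonal. -/
theorem sum_perm_eq_sum_diagonal [DecidableEq ι] (m : MultilinearMap ℂ (fun _ : ι => E) F)
    (f : ι → E) :
    ∑ σ : Equiv.Perm ι, m (fun i => f (σ i)) =
      ∑ s : Finset ι, (-1 : ℂ) ^ (sᶜ).card • m (fun _ => ∑ j ∈ s, f j) := by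
  have hdec : ∀ (r : ι → ι) (s : Finset ι), Decidable (Set.range r ⊆ (s : Set ι)) :=
    fun _ _ => Classical.propDecidable _
  have h1 : ∀ s : Finset ι, m (fun _ => ∑ j ∈ s, f j) =
      ∑ r : ι → ι, if Set.range r ⊆ s then m (fun i => f (r i)) else 0 := by
    intro s
    rw [m.map_sum_finset (fun _ j => f j) (fun _ => s), ← Finset.sum_filter]
    refine Finset.sum_congr ?_ fun _ _ => rfl
    ext r
    simp [Fintype.mem_piFinset, Set.range_subset_iff]
  -- Inclusion–exclusion: the complements of such `s` are all the subsets of the complement of the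
  -- range, and their signs cancel unless that set is empty.
  have h2 : ∀ r : ι → ι, (∑ s : Finset ι, if Set.range r ⊆ s then (-1 : ℂ) ^ (sᶜ).card else 0) =
      if Function.Surjective r then 1 else 0 := by
    intro r
    have h3 : (∑ s : Finset ι, if Set.range r ⊆ s then (-1 : ℂ) ^ (sᶜ).card else 0) =
        ∑ s ∈ (Finset.univ \ Finset.univ.image r).powerset, (-1 : ℂ) ^ s.card := by
      rw [← Finset.sum_filter]
      refine Finset.sum_nbij' (fun s => sᶜ) (fun s => sᶜ) ?_ ?_ ?_ ?_ ?_
      · intro s hs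
        simp only [Finset.mem_filter, Finset.mem_univ, true_and, Set.range_subset_iff,
          Finset.mem_coe] at hs
        simp only [Finset.mem_powerset]
        intro x hx
        simp only [Finset.mem_compl] at hx
        simp only [Finset.mem_sdiff, Finset.mem_univ, true_and, Finset.mem_image, not_exists]
        rintro y rfl
        exact hx (hs y)
      · intro s hs
        simp only [Finset.mem_filter, Finset.mem_univ, true_and, Set.range_subset_iff,
          Finset.mem_coe, Finset.mem_compl]
        intro y hy
        have := Finset.mem_powerset.1 hs hy
        simp at this
      · simp
      · simp
      · simp
    have h4 := congrArg (Int.cast : ℤ → ℂ) (Finset.sum_powerset_neg_one_pow_card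
      (x := Finset.univ \ Finset.univ.image r))
    push_cast at h4
    rw [h3, h4]
    congr 1
    simp only [Finset.sdiff_eq_empty_iff_subset, Finset.univ_subset_iff, eq_iff_iff,
      Finset.eq_univ_iff_forall, Finset.mem_image, Finset.mem_univ, true_and]
    rfl
  calc ∑ σ : Equiv.Perm ι, m (fun i => f (σ i))
      = ∑ r : ι → ι, if Function.Surjective r then m (fun i => f (r i)) else 0 := by
        rw [← Finset.sum_filter]
        refine Finset.sum_bij (fun σ _ => (σ : ι → ι)) ?_ ?_ ?_ ?_
        · intro σ _
          simpa using σ.surjective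
        · intro σ _ τ _ h
          exact DFunLike.coe_injective h
        · intro r hr
          have hr' : Function.Surjective r := by simpa using hr
          exact ⟨Equiv.ofBijective r (Finite.surjective_iff_bijective.1 hr'), Finset.mem_univ _, rfl⟩
        · intros
          rfl
    _ = ∑ r : ι → ι, (∑ s : Finset ι, if Set.range r ⊆ s then (-1 : ℂ) ^ (sᶜ).card else 0) •
          m (fun i => f (r i)) := by
        refine Finset.sum_congr rfl fun r _ => ?_
        rw [h2]
        by_cases hr : Function.Surjective r <;> simp [hr]
    _ = _ := by
        simp_rw [Finset.sum_smul, h1, Finset.smul_sum]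
        rw [Finset.sum_comm]
        refine Finset.sum_congr rfl fun s _ => Finset.sum_congr rfl fun r _ => ?_
        split_ifs <;> simp

/-- The diagonal value of a multilinear map on `End W` at any endomorphism is a combination of its
diagonal values at invertible endomorphisms. -/
theorem diagonal_mem_span_units {W : Type*} [AddCommGroup W] [Module ℂ W] [FiniteDimensional ℂ W]
    (m : MultilinearMap ℂ (fun _ : ι => Module.End ℂ W) F) (h : Module.End ℂ W) :
    m (fun _ => h) ∈ Submodule.span ℂ {x | ∃ g : Module.End ℂ W, IsUnit g ∧ m (fun _ => g) = x} := by
  classical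
  by_contra hn
  obtain ⟨φ, hφ, hle⟩ := Submodule.exists_le_ker_of_notMem hn
  -- `p` is `t ↦ φ (m (h + t, …, h + t))`. It vanishes wherever `h + t` is invertible, that is, off
  -- the finite spectrum of `-h`, so also at `t = 0`.
  let p : Polynomial ℂ := ∑ s : Finset ι,
    Polynomial.monomial (sᶜ).card (φ (m (s.piecewise (fun _ => h) (fun _ => 1))))
  have hp : ∀ t : ℂ, p.eval t = φ (m (fun _ => h + t • 1)) := by
    intro t
    have h1 : (fun _ : ι => h + t • (1 : Module.End ℂ W)) = (fun _ => h) + fun _ => t • 1 := rfl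
    rw [h1, m.map_add_univ, map_sum, Polynomial.eval_finsetSum]
    refine Finset.sum_congr rfl fun s _ => ?_
    have h2 : s.piecewise (fun _ : ι => h) (fun _ => t • (1 : Module.End ℂ W)) =
        fun i => (if i ∈ s then 1 else t) • s.piecewise (fun _ => h) (fun _ => 1) i := by
      ext1 i
      by_cases hi : i ∈ s <;> simp [hi]
    rw [h2, m.map_smul_univ, map_smul, Polynomial.eval_monomial, smul_eq_mul, mul_comm]
    congr 1
    rw [Finset.prod_ite]
    simp [Finset.filter_not, Finset.compl_eq_univ_sdiff]
  have hfin : (spectrum ℂ (-h)).Finite := Module.End.finite_spectrum (-h)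
  have hp0 : p = 0 := by
    refine Polynomial.eq_zero_of_infinite_isRoot p (hfin.infinite_compl.mono ?_)
    intro t ht
    have hu : IsUnit (h + t • (1 : Module.End ℂ W)) := by
      have := spectrum.notMem_iff.1 ht
      rwa [sub_neg_eq_add, Algebra.algebraMap_eq_smul_one, add_comm] at this
    show p.eval t = 0
    rw [hp]
    exact hle (Submodule.subset_span ⟨_, hu, rfl⟩)
  have := hp 0
  rw [hp0] at this
  simp at this
  exact hφ this.symm

end Polarization

/-! ### The commutant of the permutations on a tensor power -/

section Commutant

variable {W : Type*} [AddCommGroup W] [Module ℂ W]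

/-- The permutation representation on a tensor power. -/
def permRep (ι W : Type*) [AddCommGroup W] [Module ℂ W] :
    Representation ℂ (Equiv.Perm ι) (⨂[ℂ] _ : ι, W) where
  toFun σ := (PiTensorProduct.reindex ℂ (fun _ => W) σ).toLinearMap
  map_one' := by
    ext x
    exact PiTensorProduct.reindex_tprod _ _
  map_mul' σ τ := by
    ext x
    simp only [LinearMap.compMultilinearMap_apply, LinearEquiv.coe_coe, Module.End.mul_apply,
      PiTensorProduct.reindex_tprod]
    rfl

theorem permRep_tprod {ι : Type*} (σ : Equiv.Perm ι) (x : ι → W) :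
    permRep ι W σ (PiTensorProduct.tprod ℂ x) =
      PiTensorProduct.tprod ℂ fun i => x (σ.symm i) :=
  PiTensorProduct.reindex_tprod _ _

theorem permRep_map_inv {ι : Type*} (σ : Equiv.Perm ι) (f : ι → Module.End ℂ W) :
    permRep ι W σ * PiTensorProduct.map f * permRep ι W σ⁻¹ =
      PiTensorProduct.map fun i => f (σ.symm i) := by
  ext x
  simp only [LinearMap.compMultilinearMap_apply, Module.End.mul_apply, permRep_tprod,
    PiTensorProduct.map_tprod]
  congr! 3 with i
  exact congrArg x (σ.apply_symm_apply i)

theorem tensorPowerRep_comm_permRep {G : Type*} [Group G] (ρ : Representation ℂ G W)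
    {ι : Type*} (g : G) (σ : Equiv.Perm ι) (x : ⨂[ℂ] _ : ι, W) :
    tensorPowerRep ρ ι g (permRep ι W σ x) = permRep ι W σ (tensorPowerRep ρ ι g x) := by
  have : tensorPowerRep ρ ι g ∘ₗ permRep ι W σ = permRep ι W σ ∘ₗ tensorPowerRep ρ ι g := by
    ext y
    simp [permRep_tprod, tensorPowerRep]
  exact LinearMap.congr_fun this x

variable [FiniteDimensional ℂ W] {ι : Type*} [Fintype ι]

/-- Coordinates in the product basis are products of coordinates, so a rank-one operator with pure
tensor value is a tensor product of rank-one operators. -/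
theorem mem_span_range_map (F : Module.End ℂ (⨂[ℂ] _ : ι, W)) :
    F ∈ Submodule.span ℂ (Set.range fun f : ι → Module.End ℂ W => PiTensorProduct.map f) := by
  classical
  let b := Module.finBasis ℂ W
  let B := Basis.piTensorProduct fun _ : ι => b
  have hF : F = ∑ q, (B.coord q).smulRight (F (B q)) := by
    refine B.ext fun q => ?_
    simp [Finsupp.single_apply]
  rw [hF]
  refine Submodule.sum_mem _ fun q _ => ?_
  have hx : F (B q) ∈ Submodule.span ℂ (Set.range (PiTensorProduct.tprod ℂ)) := by
    rw [PiTensorProduct.span_tprod_eq_top]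
    trivial
  generalize F (B q) = x at hx
  induction hx using Submodule.span_induction with
  | mem x hx =>
    obtain ⟨x, rfl⟩ := hx
    refine Submodule.subset_span ⟨fun i => (b.coord (q i)).smulRight (x i), ?_⟩
    ext y
    simp only [LinearMap.compMultilinearMap_apply, PiTensorProduct.map_tprod,
      LinearMap.smulRight_apply, Module.Basis.coord_apply]
    rw [MultilinearMap.map_smul_univ]
    simp [B]
  | zero => simp
  | add x y _ _ hx hy =>
    have : (B.coord q).smulRight (x + y) = (B.coord q).smulRight x + (B.coord q).smulRight y :=
      LinearMap.ext fun z => smul_add _ _ _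
    rw [this]
    exact Submodule.add_mem _ hx hy
  | smul a x _ hx =>
    have : (B.coord q).smulRight (a • x) = a • (B.coord q).smulRight x :=
      LinearMap.ext fun z => smul_comm _ _ _
    rw [this]
    exact Submodule.smul_mem _ _ hx

/-- If `ρ` hits every automorphism of `W`, an endomorphism of `W^{⊗ ι}` commuting with the
permutations of the factors is a combination of the operators of the tensor power of `ρ`. -/
theorem mem_span_tensorPowerRep {G : Type*} [Group G] {ρ : Representation ℂ G W}
    (hρ : ∀ f : Module.End ℂ W, IsUnit f → ∃ g, ρ g = f) (F : Module.End ℂ (⨂[ℂ] _ : ι, W))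
    (hF : ∀ (σ : Equiv.Perm ι) x, F (permRep ι W σ x) = permRep ι W σ (F x)) :
    F ∈ Submodule.span ℂ (Set.range (tensorPowerRep ρ ι)) := by
  classical
  -- Conjugating over all permutations symmetrizes a tensor product of operators, so polarization
  -- applies; it multiplies `F` by the order of the group.
  let avg : Module.End ℂ (⨂[ℂ] _ : ι, W) →ₗ[ℂ] Module.End ℂ (⨂[ℂ] _ : ι, W) :=
    ∑ σ : Equiv.Perm ι, LinearMap.mulLeftRight ℂ (permRep ι W σ, permRep ι W σ⁻¹)
  have havg : ∀ H, avg H ∈ Submodule.span ℂ (Set.range (tensorPowerRep ρ ι)) := by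
    intro H
    have hH := mem_span_range_map H
    induction hH using Submodule.span_induction with
    | mem x hx =>
      obtain ⟨f, rfl⟩ := hx
      have h1 : avg (PiTensorProduct.map f) = ∑ σ : Equiv.Perm ι,
          PiTensorProduct.mapMultilinear ℂ (fun _ : ι => W) (fun _ => W) (fun i => f (σ i)) := by
        simp only [avg, LinearMap.sum_apply, LinearMap.mulLeftRight_apply, permRep_map_inv]
        exact Fintype.sum_equiv (Equiv.inv _) _ _ fun σ => rfl
      rw [h1, sum_perm_eq_sum_diagonal]
      refine Submodule.sum_mem _ fun s _ => Submodule.smul_mem _ _ ?_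
      refine Submodule.span_mono ?_ (diagonal_mem_span_units _ _)
      rintro _ ⟨g, hg, rfl⟩
      obtain ⟨g, rfl⟩ := hρ g hg
      exact ⟨g, rfl⟩
    | zero => simp
    | add x y _ _ hx hy => rw [map_add]; exact Submodule.add_mem _ hx hy
    | smul a x _ hx => rw [map_smul]; exact Submodule.smul_mem _ _ hx
  have h2 : avg F = (Fintype.card (Equiv.Perm ι) : ℂ) • F := by
    have : ∀ σ : Equiv.Perm ι, permRep ι W σ * F * permRep ι W σ⁻¹ = F := by
      intro σ
      refine LinearMap.ext fun x => ?_
      simp only [Module.End.mul_apply]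
      rw [← hF, ← Module.End.mul_apply (permRep ι W σ), ← map_mul]
      simp
    simp [avg, this, Finset.sum_const, Nat.cast_smul_eq_nsmul]
  have h3 : (Fintype.card (Equiv.Perm ι) : ℂ) ≠ 0 := Nat.cast_ne_zero.2 Fintype.card_ne_zero
  have h4 := Submodule.smul_mem _ (Fintype.card (Equiv.Perm ι) : ℂ)⁻¹ (havg F)
  rwa [h2, inv_smul_smul₀ h3] at h4

end Commutant

/-! ### Combinatorics of the Young symmetrizer -/

section YoungSymmetrizer

theorem sum_range_card_le_sum (s : Finset ℕ) :
    ∑ i ∈ Finset.range s.card, i ≤ ∑ i ∈ s, i := by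
  induction s using Finset.induction_on_max with
  | empty => simp
  | insert a s ha ih =>
    have hn : a ∉ s := fun h => lt_irrefl _ (ha a h)
    have hc : s.card ≤ a := by
      simpa using Finset.card_le_card (t := Finset.range a) fun x hx => Finset.mem_range.2 (ha x hx)
    rw [Finset.card_insert_of_notMem hn, Finset.sum_range_succ, Finset.sum_insert hn]
    omega

theorem eq_range_card_of_sum_le (s : Finset ℕ)
    (h : ∑ i ∈ s, i ≤ ∑ i ∈ Finset.range s.card, i) : s = Finset.range s.card := by
  induction s using Finset.induction_on_max with
  | empty => simp
  | insert a s ha ih =>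
    have hn : a ∉ s := fun h => lt_irrefl _ (ha a h)
    have hc : s.card ≤ a := by
      simpa using Finset.card_le_card (t := Finset.range a) fun x hx => Finset.mem_range.2 (ha x hx)
    have := sum_range_card_le_sum s
    rw [Finset.card_insert_of_notMem hn, Finset.sum_range_succ, Finset.sum_insert hn] at h
    rw [Finset.card_insert_of_notMem hn, Finset.range_add_one, ← ih (by omega)]
    congr 1
    omega

variable (lam : YoungDiagram)

/-- If a permutation of the cells of a Young diagram sends any two distinct cells of one column to
different rows, it maps each column onto the set of rows met by that column. -/
theorem row_mem_of_column_injective (σ : Equiv.Perm lam.cells)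
    (h : ∀ c d : lam.cells, c.1.2 = d.1.2 → (σ c).1.1 = (σ d).1.1 → c = d) (c : lam.cells) :
    ((σ c).1.1, c.1.2) ∈ lam.cells := by
  classical
  let col : ℕ → Finset lam.cells := fun j => Finset.univ.filter fun c => c.1.2 = j
  let J : Finset ℕ := Finset.univ.image fun c : lam.cells => c.1.2
  have hsum : ∀ f : lam.cells → ℕ, ∑ c, f c = ∑ j ∈ J, ∑ c ∈ col j, f c := fun f =>
    (Finset.sum_fiberwise_of_maps_to (fun c _ => Finset.mem_image_of_mem _ (Finset.mem_univ c))
      f).symm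
  let A : ℕ → Finset ℕ := fun j => (col j).image fun c => c.1.1
  let B : ℕ → Finset ℕ := fun j => (col j).image fun c => (σ c).1.1
  have hAinj : ∀ j, Set.InjOn (fun c : lam.cells => c.1.1) (col j) := by
    intro j c hc d hd hcd
    simp only [col, Finset.coe_filter, Finset.mem_univ, true_and, Set.mem_ofPred_eq] at hc hd
    exact Subtype.ext (Prod.ext hcd (hc.trans hd.symm))
  have hBinj : ∀ j, Set.InjOn (fun c : lam.cells => (σ c).1.1) (col j) := by
    intro j c hc d hd hcd
    simp only [col, Finset.coe_filter, Finset.mem_univ, true_and, Set.mem_ofPred_eq] at hc hd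
    exact h c d (hc.trans hd.symm) hcd
  have hcard : ∀ j, (A j).card = (B j).card := fun j => by
    rw [Finset.card_image_of_injOn (hAinj j), Finset.card_image_of_injOn (hBinj j)]
  have hmemA : ∀ i j, i ∈ A j ↔ (i, j) ∈ lam.cells := by
    intro i j
    simp only [A, col, Finset.mem_image, Finset.mem_filter, Finset.mem_univ, true_and]
    constructor
    · rintro ⟨d, rfl, rfl⟩
      exact d.2
    · intro hij
      exact ⟨⟨(i, j), hij⟩, rfl, rfl⟩
  have hA : ∀ j, A j = Finset.range (A j).card := by
    intro j
    have : A j = Finset.range (lam.colLen j) := by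
      ext i
      rw [hmemA, Finset.mem_range, ← YoungDiagram.mem_iff_lt_colLen, YoungDiagram.mem_cells]
    rw [this, Finset.card_range]
  -- The rows of a column form an initial segment, which has least sum among sets of its size. As
  -- `σ` preserves the total of all row indices, equality holds in every column.
  have hle : ∀ j ∈ J, ∑ i ∈ A j, i ≤ ∑ i ∈ B j, i := by
    intro j _
    rw [hA j, hcard j]
    exact sum_range_card_le_sum _
  have htot : ∑ j ∈ J, ∑ i ∈ A j, i = ∑ j ∈ J, ∑ i ∈ B j, i := by
    simp only [A, B]
    rw [Finset.sum_congr rfl fun j _ => Finset.sum_image (hAinj j),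
      Finset.sum_congr rfl fun j _ => Finset.sum_image (hBinj j), ← hsum, ← hsum]
    exact (Equiv.sum_comp σ fun c : lam.cells => c.1.1).symm
  have heq := (Finset.sum_eq_sum_iff_of_le hle).1 htot c.1.2
    (Finset.mem_image_of_mem _ (Finset.mem_univ c))
  have hB : B c.1.2 = A c.1.2 := by
    rw [eq_range_card_of_sum_le (B c.1.2) (by rw [← hcard, ← hA, heq]), hA, hcard]
  rw [← hmemA, ← hB]
  exact Finset.mem_image_of_mem _ (by simp [col])

/-- Let `q` slide each cell within its column to the row where `σ` puts it; what remains of `σ` only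
moves cells along rows. -/
theorem exists_mul_eq_of_column_injective (σ : Equiv.Perm lam.cells)
    (h : ∀ c d : lam.cells, c.1.2 = d.1.2 → (σ c).1.1 = (σ d).1.1 → c = d) :
    ∃ p ∈ rowPerms lam, ∃ q ∈ colPerms lam, σ = p * q := by
  let q₀ : lam.cells → lam.cells := fun c =>
    ⟨((σ c).1.1, c.1.2), row_mem_of_column_injective lam σ h c⟩
  have hq : Function.Injective q₀ := by
    intro c d hcd
    have := congrArg Subtype.val hcd
    simp only [q₀, Prod.mk.injEq] at this
    exact h c d this.2 this.1
  let q : Equiv.Perm lam.cells := Equiv.ofBijective q₀ (Finite.injective_iff_bijective.1 hq)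
  refine ⟨σ * q⁻¹, ?_, q, ?_, by simp⟩
  · simp only [rowPerms, Finset.mem_filter, Finset.mem_univ, true_and]
    intro c
    obtain ⟨d, rfl⟩ := q.surjective c
    rw [Equiv.Perm.mul_apply, Equiv.Perm.inv_def, Equiv.symm_apply_apply]
    rfl
  · simp only [colPerms, Finset.mem_filter, Finset.mem_univ, true_and]
    intro c
    rfl

/-- The row symmetrizer in the group algebra. -/
def rowSym : MonoidAlgebra ℂ (Equiv.Perm lam.cells) :=
  ∑ p ∈ rowPerms lam, MonoidAlgebra.of ℂ _ p

/-- The column antisymmetrizer in the group algebra. -/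
def colAntisym : MonoidAlgebra ℂ (Equiv.Perm lam.cells) :=
  ∑ q ∈ colPerms lam, ((Equiv.Perm.sign q : ℤ) : ℂ) • MonoidAlgebra.of ℂ _ q

theorem youngSymmetrizer_eq (W : Type*) [AddCommGroup W] [Module ℂ W] :
    youngSymmetrizer W lam =
      (permRep lam.cells W).asAlgebraHom (rowSym lam * colAntisym lam) := by
  rw [map_mul, rowSym, colAntisym, map_sum, map_sum]
  simp only [map_smul, Representation.asAlgebraHom_of]
  rfl

theorem rowSym_mul_of {p : Equiv.Perm lam.cells} (hp : p ∈ rowPerms lam) :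
    rowSym lam * MonoidAlgebra.of ℂ _ p = rowSym lam := by
  simp only [rowPerms, Finset.mem_filter, Finset.mem_univ, true_and] at hp
  rw [rowSym, Finset.sum_mul]
  refine Finset.sum_equiv (Equiv.mulRight p) ?_ ?_
  · intro r
    simp only [rowPerms, Finset.mem_filter, Finset.mem_univ, true_and, Equiv.coe_mulRight,
      Equiv.Perm.mul_apply]
    constructor
    · intro h c
      rw [h, hp]
    · intro h c
      have := h (p⁻¹ c)
      have h2 := hp (p⁻¹ c)
      rw [Equiv.Perm.inv_def, Equiv.apply_symm_apply] at this h2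
      rw [this, h2]
  · intro r _
    rw [← map_mul]
    rfl

theorem of_mul_colAntisym {q : Equiv.Perm lam.cells} (hq : q ∈ colPerms lam) :
    MonoidAlgebra.of ℂ _ q * colAntisym lam = ((Equiv.Perm.sign q : ℤ) : ℂ) • colAntisym lam := by
  simp only [colPerms, Finset.mem_filter, Finset.mem_univ, true_and] at hq
  rw [colAntisym, Finset.mul_sum, Finset.smul_sum]
  refine Finset.sum_equiv (Equiv.mulLeft q) ?_ ?_
  · intro r
    simp only [colPerms, Finset.mem_filter, Finset.mem_univ, true_and, Equiv.coe_mulLeft,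
      Equiv.Perm.mul_apply, hq]
  · intro r _
    rw [mul_smul_comm, ← map_mul, smul_smul, Equiv.coe_mulLeft, Equiv.Perm.sign_mul]
    congr 1
    have : ((Equiv.Perm.sign q : ℤ) : ℂ) * ((Equiv.Perm.sign q : ℤ) : ℂ) = 1 := by
      rw [← Int.cast_mul, ← Units.val_mul, Int.units_mul_self]
      simp
    push_cast
    rw [← mul_assoc, this, one_mul]

/-- Either `σ` factors as row times column permutation and both factors are absorbed, or `σ` sends
two cells of one column to one row; the transposition of these cells then shows that the product
equals its negative. -/
theorem exists_rowSym_mul_mul_colAntisym (x : MonoidAlgebra ℂ (Equiv.Perm lam.cells)) :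
    ∃ s : ℂ, rowSym lam * x * colAntisym lam = s • (rowSym lam * colAntisym lam) := by
  induction x using MonoidAlgebra.induction_on with
  | of σ =>
    by_cases h : ∀ c d : lam.cells, c.1.2 = d.1.2 → (σ c).1.1 = (σ d).1.1 → c = d
    · obtain ⟨p, hp, q, hq, rfl⟩ := exists_mul_eq_of_column_injective lam σ h
      refine ⟨((Equiv.Perm.sign q : ℤ) : ℂ), ?_⟩
      rw [map_mul, ← mul_assoc, rowSym_mul_of lam hp, mul_assoc, of_mul_colAntisym lam hq,
        mul_smul_comm]
    · push Not at h
      obtain ⟨c, d, hcol, hrow, hne⟩ := h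
      have hq : Equiv.swap c d ∈ colPerms lam := by
        simp only [colPerms, Finset.mem_filter, Finset.mem_univ, true_and]
        intro e
        by_cases h1 : e = c
        · subst h1; simp [hcol]
        by_cases h2 : e = d
        · subst h2; simp [hcol]
        rw [Equiv.swap_apply_of_ne_of_ne h1 h2]
      have hp : Equiv.swap (σ c) (σ d) ∈ rowPerms lam := by
        simp only [rowPerms, Finset.mem_filter, Finset.mem_univ, true_and]
        intro e
        by_cases h1 : e = σ c
        · subst h1; simp [hrow]
        by_cases h2 : e = σ d
        · subst h2; simp [hrow]
        rw [Equiv.swap_apply_of_ne_of_ne h1 h2]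
      have hcomm : σ * Equiv.swap c d = Equiv.swap (σ c) (σ d) * σ := by
        rw [Equiv.swap_apply_apply]
        simp
      have h1 : rowSym lam * MonoidAlgebra.of ℂ _ σ * colAntisym lam =
          -(rowSym lam * MonoidAlgebra.of ℂ _ σ * colAntisym lam) := by
        conv_lhs => rw [← rowSym_mul_of lam hp, mul_assoc (rowSym lam), ← map_mul, ← hcomm, map_mul,
          mul_assoc, mul_assoc, of_mul_colAntisym lam hq, Equiv.Perm.sign_swap hne]
        simp [mul_assoc]
      refine ⟨0, ?_⟩
      rw [zero_smul]
      have h2 : (2 : ℂ) • (rowSym lam * MonoidAlgebra.of ℂ _ σ * colAntisym lam) = 0 := by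
        rw [two_smul]
        exact add_eq_zero_iff_eq_neg.2 h1
      exact (smul_eq_zero.1 h2).resolve_left two_ne_zero
  | add x y hx hy =>
    obtain ⟨s, hs⟩ := hx
    obtain ⟨t, ht⟩ := hy
    exact ⟨s + t, by rw [mul_add, add_mul, hs, ht, add_smul]⟩
  | smul r x hx =>
    obtain ⟨s, hs⟩ := hx
    exact ⟨r * s, by rw [mul_smul_comm, smul_mul_assoc, hs, smul_smul]⟩

end YoungSymmetrizer

/-! ### Irreducibility of Schur modules -/

section Simple

/-- The assignment `r • x ↦ r • y` is well defined on the cyclic submodule of `x` and extends by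
semisimplicity. -/
theorem exists_end_apply_eq {R M : Type*} [Ring R] [AddCommGroup M] [Module R M]
    [IsSemisimpleModule R M] (x y : M) (h : ∀ r : R, r • x = 0 → r • y = 0) :
    ∃ f : M →ₗ[R] M, f x = y := by
  let φ := LinearMap.toSpanSingleton R M x
  let ψ := LinearMap.toSpanSingleton R M y
  have hk : LinearMap.ker φ ≤ LinearMap.ker ψ := fun r hr => h r hr
  obtain ⟨f, hf⟩ := IsSemisimpleModule.extension_property ((LinearMap.ker φ).liftQ φ le_rfl)
    (LinearMap.ker_eq_bot.1 (Submodule.ker_liftQ_eq_bot' _ _ rfl))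
    ((LinearMap.ker φ).liftQ ψ hk)
  refine ⟨f, ?_⟩
  have := LinearMap.congr_fun hf (Submodule.Quotient.mk 1)
  simpa [φ, ψ] using this

/-- The left ideal of `w` is generated by an idempotent `e = b * w`, and `w * e = w`. -/
theorem exists_eq_mul_mul_self {R : Type*} [Ring R] [IsSemisimpleRing R] (w : R) :
    ∃ b, w = w * b * w := by
  obtain ⟨e, he, hI⟩ := IsSemisimpleRing.ideal_eq_span_idempotent (Ideal.span {w})
  obtain ⟨b, hb⟩ := Ideal.mem_span_singleton'.1
    (hI ▸ Ideal.mem_span_singleton_self e : e ∈ Ideal.span {w})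
  obtain ⟨a, ha⟩ := Ideal.mem_span_singleton'.1
    (hI ▸ Ideal.mem_span_singleton_self w : w ∈ Ideal.span {e})
  refine ⟨b, ?_⟩
  rw [mul_assoc, hb, ← ha, mul_assoc, he]

variable {W G : Type*} [AddCommGroup W] [Module ℂ W] [Group G] {ρ : Representation ℂ G W}

theorem exists_youngSymmetrizer_apply_eq (lam : YoungDiagram) (u v : ⨂[ℂ] _ : lam.cells, W)
    (hu : youngSymmetrizer W lam u ≠ 0) :
    ∃ F : Module.End ℂ (⨂[ℂ] _ : lam.cells, W),
      (∀ (σ : Equiv.Perm lam.cells) x,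
        F (permRep lam.cells W σ x) = permRep lam.cells W σ (F x)) ∧
      F (youngSymmetrizer W lam u) = youngSymmetrizer W lam v := by
  let A := MonoidAlgebra ℂ (Equiv.Perm lam.cells)
  let c : A := rowSym lam * colAntisym lam
  let Φ := (permRep lam.cells W).asAlgebraHom
  have hc : youngSymmetrizer W lam = Φ c := youngSymmetrizer_eq lam W
  -- With `r c = r c b r c` and `c b r c = s c`, applying the latter to `u` gives `s = 0`, because
  -- `c u ≠ 0`; hence `r c = 0`. So whatever kills `c u` also kills `c v`.
  have key : ∀ r : A, Φ r (Φ c u) = 0 → r * c = 0 := by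
    intro r hr
    obtain ⟨b, hb⟩ := exists_eq_mul_mul_self (r * c)
    obtain ⟨s, hs⟩ := exists_rowSym_mul_mul_colAntisym lam (colAntisym lam * b * r * rowSym lam)
    have hs' : c * b * (r * c) = s • c := by
      rw [← hs]
      simp only [c, mul_assoc]
    have h1 : s • Φ c u = 0 := by
      rw [← LinearMap.smul_apply, ← map_smul, ← hs', map_mul, map_mul Φ r c, Module.End.mul_apply,
        Module.End.mul_apply, hr, map_zero]
    rcases smul_eq_zero.1 h1 with h0 | h0
    · rw [h0, zero_smul] at hs'
      rw [hb, mul_assoc, mul_assoc, ← mul_assoc c, hs', mul_zero]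
    · exact absurd (hc ▸ h0) hu
  obtain ⟨f, hf⟩ := exists_end_apply_eq (R := A) (M := (permRep lam.cells W).asModule)
    (Φ c u) (Φ c v) (fun r hr => by
      have h1 := key r hr
      change Φ r (Φ c v) = 0
      rw [← Module.End.mul_apply, ← map_mul, h1, map_zero, LinearMap.zero_apply])
  let F := (IntertwiningMap.equivLinearMapAsModule (permRep lam.cells W) (permRep lam.cells W)).symm f
  refine ⟨F.toLinearMap, fun σ x => IntertwiningMap.isIntertwining _ _ F σ x, ?_⟩
  rw [hc]
  exact hf

/-- `S_lam W` is irreducible (if it is nonzero) for a group acting on `W` through all of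
`GL(W)`. -/
theorem isIrreducible_schurRep [FiniteDimensional ℂ W]
    (hρ : ∀ f : Module.End ℂ W, IsUnit f → ∃ g, ρ g = f)
    (lam : YoungDiagram) [Nontrivial (SchurModule lam W)] : (schurRep lam ρ).IsIrreducible := by
  have hnt : Nontrivial (Subrepresentation (schurRep lam ρ)) := by
    obtain ⟨x, hx⟩ := exists_ne (0 : SchurModule lam W)
    refine ⟨⊥, ⊤, fun h => hx ?_⟩
    have : x ∈ (⊤ : Subrepresentation (schurRep lam ρ)) := Submodule.mem_top
    rw [← h] at this
    exact this
  refine ⟨fun N => or_iff_not_imp_left.2 fun hN => ?_⟩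
  obtain ⟨x, hxN, hx⟩ : ∃ x ∈ N.toSubmodule, x ≠ 0 := by
    refine Submodule.exists_mem_ne_zero_of_ne_bot fun h => hN ?_
    exact Subrepresentation.toSubmodule_injective h
  refine Subrepresentation.toSubmodule_injective (Submodule.eq_top_iff'.2 fun y => ?_)
  obtain ⟨u, hu⟩ := x.2
  obtain ⟨v, hv⟩ := y.2
  obtain ⟨F, hF, hFx⟩ := exists_youngSymmetrizer_apply_eq lam u v (by
    rw [hu]
    exact fun h => hx (Subtype.ext h))
  rw [hu, hv] at hFx
  -- `F` takes `x` to `y` and is a combination of group operators, so `y` lies in every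
  -- subrepresentation containing `x`.
  have hspan := mem_span_tensorPowerRep hρ F hF
  have hmem : ∀ H ∈ Submodule.span ℂ (Set.range (tensorPowerRep ρ lam.cells)),
      ∃ z ∈ N.toSubmodule, z.1 = H x.1 := by
    intro H hH
    induction hH using Submodule.span_induction with
    | mem H hH =>
      obtain ⟨g, rfl⟩ := hH
      exact ⟨schurRep lam ρ g x, N.apply_mem_toSubmodule g hxN, rfl⟩
    | zero => exact ⟨0, Submodule.zero_mem _, rfl⟩
    | add H K _ _ hH hK =>
      obtain ⟨z, hz, hz'⟩ := hH
      obtain ⟨w, hw, hw'⟩ := hK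
      exact ⟨z + w, Submodule.add_mem _ hz hw, by
        rw [LinearMap.add_apply, ← hz', ← hw']; rfl⟩
    | smul a H _ hH =>
      obtain ⟨z, hz, hz'⟩ := hH
      exact ⟨a • z, Submodule.smul_mem _ a hz, by
        rw [LinearMap.smul_apply, ← hz']; rfl⟩
  obtain ⟨z, hz, hz'⟩ := hmem F hspan
  have : z = y := Subtype.ext (hz'.trans hFx)
  exact this ▸ hz

end Simple

/-! ### Semisimplicity of tensor powers -/

section Semisimple

variable {W G : Type*} [AddCommGroup W] [Module ℂ W] [FiniteDimensional ℂ W] [Group G]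
  {ρ : Representation ℂ G W}

/-- Subrepresentations of `W^{⊗ ι}` are submodules over the commutant of the permutations. -/
def subrepresentationOrderIso (hρ : ∀ f : Module.End ℂ W, IsUnit f → ∃ g, ρ g = f)
    (ι : Type*) [Fintype ι] :
    Subrepresentation (tensorPowerRep ρ ι) ≃o
      Submodule (Module.End (MonoidAlgebra ℂ (Equiv.Perm ι)) (permRep ι W).asModule)
        (permRep ι W).asModule where
  toFun N :=
    { carrier := (N.toSubmodule : Set (⨂[ℂ] _ : ι, W))
      add_mem' := N.toSubmodule.add_mem
      zero_mem' := N.toSubmodule.zero_mem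
      smul_mem' := by
        intro f x hx
        let F := (IntertwiningMap.equivLinearMapAsModule (permRep ι W) (permRep ι W)).symm f
        have hspan := mem_span_tensorPowerRep hρ F.toLinearMap fun σ x => IntertwiningMap.isIntertwining _ _ F σ x
        have hmem : ∀ H ∈ Submodule.span ℂ (Set.range (tensorPowerRep ρ ι)),
            H x ∈ N.toSubmodule := by
          intro H hH
          induction hH using Submodule.span_induction with
          | mem H hH =>
            obtain ⟨g, rfl⟩ := hH
            exact N.apply_mem_toSubmodule g hx
          | zero => exact Submodule.zero_mem _
          | add H K _ _ hH hK => exact Submodule.add_mem _ hH hK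
          | smul a H _ hH => exact Submodule.smul_mem _ a hH
        exact hmem _ hspan }
  invFun N :=
    { toSubmodule :=
        { carrier := (N : Set (permRep ι W).asModule)
          add_mem' := N.add_mem
          zero_mem' := N.zero_mem
          smul_mem' := fun a x hx =>
            N.smul_mem (IntertwiningMap.equivLinearMapAsModule _ _ (a • IntertwiningMap.id _)) hx }
      apply_mem_toSubmodule := fun g x hx =>
        N.smul_mem (IntertwiningMap.equivLinearMapAsModule _ _
          ⟨tensorPowerRep ρ ι g, fun σ => LinearMap.ext (tensorPowerRep_comm_permRep ρ g σ)⟩) hx }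
  left_inv _ := rfl
  right_inv _ := rfl
  map_rel_iff' := Iff.rfl

/-- The tensor power is a finite module over a semisimple group algebra, so its endomorphism ring is
semisimple; complements of submodules over that ring are complements of subrepresentations. -/
theorem isSemisimpleRepresentation_tensorPowerRep
    (hρ : ∀ f : Module.End ℂ W, IsUnit f → ∃ g, ρ g = f) (ι : Type*) [Fintype ι] :
    (tensorPowerRep ρ ι).IsSemisimpleRepresentation := by
  classical
  have : Module.Finite (MonoidAlgebra ℂ (Equiv.Perm ι)) (permRep ι W).asModule :=
    Module.Finite.of_restrictScalars_finite ℂ _ _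
  have := IsSemisimpleRing.moduleEnd (MonoidAlgebra ℂ (Equiv.Perm ι)) (permRep ι W).asModule
  refine (subrepresentationOrderIso hρ ι).complementedLattice_iff.2 ?_
  exact (isSemisimpleModule_iff (Module.End (MonoidAlgebra ℂ (Equiv.Perm ι)) (permRep ι W).asModule)
    (permRep ι W).asModule).1 inferInstance

end Semisimple

/-! ### Representations embedding in tensor powers -/

section Polynomial

variable {W G : Type*} [AddCommGroup W] [Module ℂ W] [Group G]

/-- A representation embedding into some tensor power of `ρ`. -/
def EmbedsInTensorPower (ρ : Representation ℂ G W) {U : Type*} [AddCommGroup U] [Module ℂ U]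
    (τ : Representation ℂ G U) : Prop :=
  ∃ (ι : Type) (_ : Fintype ι) (f : IntertwiningMap τ (tensorPowerRep ρ ι)),
    Function.Injective f

theorem embedsInTensorPower_self (ρ : Representation ℂ G W) : EmbedsInTensorPower ρ ρ := by
  let e := PiTensorProduct.subsingletonEquiv (R := ℂ) (s := fun _ : Unit => W) ()
  refine ⟨Unit, inferInstance, ⟨e.symm.toLinearMap, fun g => ?_⟩, e.symm.injective⟩
  ext x
  simp [e, tensorPowerRep, PiTensorProduct.subsingletonEquiv_symm_apply']

theorem embedsInTensorPower_schurRep (ρ : Representation ℂ G W) (lam : YoungDiagram) :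
    EmbedsInTensorPower ρ (schurRep lam ρ) :=
  ⟨lam.cells, inferInstance, ⟨(LinearMap.range (youngSymmetrizer W lam)).subtype, fun _ => rfl⟩,
    Subtype.val_injective⟩

theorem EmbedsInTensorPower.tprod {ρ : Representation ℂ G W} {U U' : Type*} [AddCommGroup U]
    [Module ℂ U] [AddCommGroup U'] [Module ℂ U'] {τ : Representation ℂ G U}
    {τ' : Representation ℂ G U'} (h : EmbedsInTensorPower ρ τ) (h' : EmbedsInTensorPower ρ τ') :
    EmbedsInTensorPower ρ (τ.tprod τ') := by
  obtain ⟨ι, _, f, hf⟩ := h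
  obtain ⟨ι', _, f', hf'⟩ := h'
  let e := PiTensorProduct.tmulEquiv ℂ W (ι := ι) (ι₂ := ι')
  let m : IntertwiningMap ((tensorPowerRep ρ ι).tprod (tensorPowerRep ρ ι'))
      (tensorPowerRep ρ (ι ⊕ ι')) := ⟨e.toLinearMap, fun g => by
    ext x y
    simp only [e, tensorPowerRep, LinearMap.compMultilinearMap_apply,
      TensorProduct.AlgebraTensorModule.curry_apply, TensorProduct.curry_apply,
      LinearMap.restrictScalars_self, LinearMap.comp_apply, LinearEquiv.coe_coe,
      Representation.tprod_apply, TensorProduct.map_tmul, MonoidHom.coe_mk, OneHom.coe_mk,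
      PiTensorProduct.map_tprod, PiTensorProduct.tmulEquiv_apply]
    congr 1
    ext i
    cases i <;> rfl⟩
  refine ⟨ι ⊕ ι', inferInstance, m.comp (f.tensor f'), ?_⟩
  exact e.injective.comp (TensorProduct.map_injective_of_flat_flat f.toLinearMap f'.toLinearMap hf hf')

theorem EmbedsInTensorPower.isSemisimpleModule [FiniteDimensional ℂ W]
    {ρ : Representation ℂ G W} (hρ : ∀ f : Module.End ℂ W, IsUnit f → ∃ g, ρ g = f)
    {U : Type*} [AddCommGroup U] [Module ℂ U] {τ : Representation ℂ G U}
    (h : EmbedsInTensorPower ρ τ) : IsSemisimpleModule (MonoidAlgebra ℂ G) τ.asModule := by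
  obtain ⟨ι, _, f, hf⟩ := h
  have := (isSemisimpleRepresentation_iff_isSemisimpleModule_asModule _).1
    (isSemisimpleRepresentation_tensorPowerRep hρ ι)
  exact IsSemisimpleModule.of_injective (IntertwiningMap.equivLinearMapAsModule _ _ f) hf

end Polynomial

/-! ### Isotypic components under injections and surjections -/

section Isotypic

variable {R D E F N S : Type*} [Ring R] [AddCommGroup D] [Module R D] [AddCommGroup E]
  [Module R E] [AddCommGroup F] [Module R F] [AddCommGroup N] [Module R N] [AddCommGroup S]
  [Module R S] [IsSimpleModule R S]

/-- By semisimplicity `p` has a section, and the section also respects isotypic components. -/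
theorem map_isotypicComponent_of_surjective [IsSemisimpleModule R E] (p : E →ₗ[R] F)
    (hp : Function.Surjective p) :
    (isotypicComponent R E S).map p = isotypicComponent R F S := by
  refine le_antisymm (Submodule.map_le_iff_le_comap.2 (p.le_comap_isotypicComponent S)) ?_
  obtain ⟨s, hs⟩ := IsSemisimpleModule.lifting_property p hp LinearMap.id
  intro x hx
  exact ⟨s x, s.le_comap_isotypicComponent S hx, LinearMap.congr_fun hs x⟩

/-- Through the two identifications, `i` becomes an injective endomorphism of the Artinian module
`S^M`, hence is surjective. -/
theorem map_isotypicComponent_of_injective (i : D →ₗ[R] E) (hi : Function.Injective i) (M : ℕ)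
    (hD : Nonempty (isotypicComponent R D S ≃ₗ[R] (Fin M → S)))
    (hE : Nonempty (isotypicComponent R E S ≃ₗ[R] (Fin M → S))) :
    (isotypicComponent R D S).map i = isotypicComponent R E S := by
  obtain ⟨d⟩ := hD
  obtain ⟨e⟩ := hE
  refine le_antisymm (Submodule.map_le_iff_le_comap.2 (i.le_comap_isotypicComponent S)) ?_
  let i' : isotypicComponent R D S →ₗ[R] isotypicComponent R E S :=
    i.restrict (i.le_comap_isotypicComponent S)
  have hi' : Function.Injective i' := fun x y h => Subtype.ext (hi (congrArg Subtype.val h))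
  have hsurj : Function.Surjective (e.toLinearMap ∘ₗ i' ∘ₗ d.symm.toLinearMap) :=
    IsArtinian.surjective_of_injective_endomorphism _
      (e.injective.comp (hi'.comp d.symm.injective))
  intro x hx
  obtain ⟨z, hz⟩ := hsurj (e ⟨x, hx⟩)
  have h := e.injective hz
  exact ⟨d.symm z, (d.symm z).2, congrArg Subtype.val h⟩

theorem nonempty_isotypicComponent_equiv_of_injective (j : N →ₗ[R] F) (hj : Function.Injective j)
    (hr : isotypicComponent R F S ≤ LinearMap.range j) :
    Nonempty (isotypicComponent R N S ≃ₗ[R] isotypicComponent R F S) := by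
  let j' : isotypicComponent R N S →ₗ[R] isotypicComponent R F S :=
    j.restrict (j.le_comap_isotypicComponent S)
  refine ⟨LinearEquiv.ofBijective j' ⟨fun x y h => Subtype.ext (hj (congrArg Subtype.val h)), ?_⟩⟩
  -- The inverse of `j` on the component of `F`; its source is isotypic of type `S`, so it lands in
  -- the component of `N`.
  let k : isotypicComponent R F S →ₗ[R] N :=
    (LinearEquiv.ofInjective j hj).symm.toLinearMap ∘ₗ Submodule.inclusion hr
  have hk : ∀ x, j (k x) = x := fun x =>
    congrArg Subtype.val ((LinearEquiv.ofInjective j hj).apply_symm_apply (Submodule.inclusion hr x))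
  have htop : isotypicComponent R (isotypicComponent R F S) S = ⊤ := by
    rw [isotypicComponent_eq_top_iff]
    exact IsIsotypicOfType.isotypicComponent R F S
  intro x
  refine ⟨⟨k x, k.le_comap_isotypicComponent S (htop ▸ Submodule.mem_top)⟩, Subtype.ext (hk x)⟩

/-- If `S` has the same multiplicity in `D` and in the semisimple module `E`, it keeps this
multiplicity in the image of a composition `D ↪ E ↠ F` with `F ≃ D`. -/
theorem nonempty_isotypicComponent_range_equiv [IsSemisimpleModule R E] (i : D →ₗ[R] E)
    (hi : Function.Injective i) (p : E →ₗ[R] F) (hp : Function.Surjective p) (e : D ≃ₗ[R] F)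
    (j : N →ₗ[R] F) (hj : Function.Injective j)
    (hr : LinearMap.range (p ∘ₗ i) ≤ LinearMap.range j) (M : ℕ)
    (hD : Nonempty (isotypicComponent R D S ≃ₗ[R] (Fin M → S)))
    (hE : Nonempty (isotypicComponent R E S ≃ₗ[R] (Fin M → S))) :
    Nonempty (isotypicComponent R N S ≃ₗ[R] (Fin M → S)) := by
  have h1 : isotypicComponent R F S ≤ LinearMap.range j := by
    refine le_trans ?_ hr
    rw [← map_isotypicComponent_of_surjective p hp,
      ← map_isotypicComponent_of_injective i hi M hD hE, ← Submodule.map_comp]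
    exact LinearMap.map_le_range
  obtain ⟨f⟩ := nonempty_isotypicComponent_equiv_of_injective j hj h1
  obtain ⟨g⟩ := nonempty_isotypicComponent_equiv_of_injective (S := S) e.toLinearMap e.injective
    (by simp)
  obtain ⟨d⟩ := hD
  exact ⟨f.trans (g.symm.trans d)⟩

end Isotypic

theorem exists_dual_stdRep_eq {V : Type*} [AddCommGroup V] [Module ℂ V] [FiniteDimensional ℂ V]
    (f : Module.End ℂ (Module.Dual ℂ V)) (hf : IsUnit f) : ∃ g, (stdRep V).dual g = f := by
  let e : Module.Dual ℂ V ≃ₗ[ℂ] Module.Dual ℂ V :=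
    LinearEquiv.ofBijective f ((Module.End.isUnit_iff f).1 hf)
  let e' : V ≃ₗ[ℂ] V :=
    (Module.evalEquiv ℂ V).trans (e.dualMap.trans (Module.evalEquiv ℂ V).symm)
  -- `e'` is the transpose of `f` read on `V` by reflexivity; the inverse is taken because the dual
  -- action precomposes with `g⁻¹`.
  refine ⟨(LinearMap.GeneralLinearGroup.generalLinearEquiv ℂ V).symm e'.symm, ?_⟩
  ext φ v
  have h : φ (e' v) = f φ v := by
    have h1 : Module.evalEquiv ℂ V (e' v) = e.dualMap (Module.evalEquiv ℂ V v) := by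
      simp [e']
    have h2 := LinearMap.congr_fun h1 φ
    exact h2
  rw [← h]
  rfl

theorem HasMultiplicity.of_subsingleton {G W S : Type*} [Group G] [AddCommGroup W] [Module ℂ W]
    [AddCommGroup S] [Module ℂ S] (ρ : Representation ℂ G W) (σ : Representation ℂ G S)
    [hS : Subsingleton S] (M : ℕ) : HasMultiplicity ρ σ M := by
  have : Subsingleton σ.asModule := hS
  have h : isotypicComponent (MonoidAlgebra ℂ G) ρ.asModule σ.asModule = ⊥ := by
    refine eq_bot_iff.2 (sSup_le fun m ⟨e⟩ => ?_)
    have := e.toEquiv.subsingleton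
    exact (Submodule.eq_bot_of_subsingleton (p := m)).le
  unfold HasMultiplicity
  rw [h]
  exact ⟨0⟩

end YoungFlattening

end

open YoungFlattening Representation in
theorem mainTheorem6 {V : Type*} [AddCommGroup V] [Module ℂ V] [FiniteDimensional ℂ V]
    -- `μ` and `ν` are partitions with at most `dim V` parts, `ν` being `μ` with one cell added
    (μ ν : YoungDiagram) (hμν : μ ≤ ν) (hcard : ν.card = μ.card + 1)
    (hν : ν.colLen 0 ≤ Module.finrank ℂ V)
    -- the invariant tensor, as an equivariant map `S_ν V* → V* ⊗ S_μ V*`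
    (T : IntertwiningMap (schurDual ν V) ((stdRep V).dual.tprod (schurDual μ V))) (hT : T ≠ 0)
    -- the equivariant projection `S_μ V* ⊗ V* → S_ν V*`
    (P : IntertwiningMap ((schurDual μ V).tprod (stdRep V).dual) (schurDual ν V)) (hP : P ≠ 0)
    -- the type `π` of an isotypic component, and its multiplicity
    (π : YoungDiagram) (hπ : π.colLen 0 ≤ Module.finrank ℂ V) (M : ℕ)
    (hdom : HasMultiplicity ((schurDual μ V).tprod (schurDual ν V)) (schurDual π V) M)
    (hmid : HasMultiplicity
      ((schurDual μ V).tprod ((stdRep V).dual.tprod (schurDual μ V))) (schurDual π V) M) :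
    HasMultiplicity (W := (youngFlattening T P).range.toSubmodule)
      (youngFlattening T P).range.toRepresentation (schurDual π V) M := by
  -- A zero type has zero isotypic components; otherwise the type is simple and the isotypic lemmas
  -- apply.
  rcases subsingleton_or_nontrivial (SchurModule π (Module.Dual ℂ V)) with hS | hS
  · exact HasMultiplicity.of_subsingleton _ _ M
  have hρ := exists_dual_stdRep_eq (V := V)
  have hirr : (schurDual π V).IsIrreducible := isIrreducible_schurRep hρ π
  have hνnt : Nontrivial (SchurModule ν (Module.Dual ℂ V)) := by
    by_contra h
    have := not_nontrivial_iff_subsingleton.1 h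
    exact hT (IntertwiningMap.ext (LinearMap.ext fun x => by
      rw [Subsingleton.elim x 0, map_zero, map_zero]))
  have hνirr : (schurDual ν V).IsIrreducible := isIrreducible_schurRep hρ ν
  have hTinj : Function.Injective T := (IsIrreducible.injective_or_eq_zero T).resolve_right hT
  have hPsurj : Function.Surjective P := (IsIrreducible.surjective_or_eq_zero P).resolve_right hP
  have hsemi : IsSemisimpleModule (MonoidAlgebra ℂ (LinearMap.GeneralLinearGroup ℂ V))
      ((schurDual μ V).tprod ((stdRep V).dual.tprod (schurDual μ V))).asModule :=
    ((embedsInTensorPower_schurRep _ μ).tprod ((embedsInTensorPower_self _).tprod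
      (embedsInTensorPower_schurRep _ μ))).isSemisimpleModule hρ
  let i := T.lTensor (schurDual μ V)
  let p := (P.rTensor (schurDual μ V)).comp
    (Representation.TensorProduct.assoc (schurDual μ V) (stdRep V).dual
      (schurDual μ V)).symm.toIntertwiningMap
  have hi : Function.Injective i := Module.Flat.lTensor_preserves_injective_linearMap _ hTinj
  have hp : Function.Surjective p :=
    (LinearMap.rTensor_surjective _ hPsurj).comp (TensorProduct.assoc ℂ _ _ _).symm.surjective
  let e : ((schurDual μ V).tprod (schurDual ν V)).asModule ≃ₗ[MonoidAlgebra ℂ _]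
      ((schurDual ν V).tprod (schurDual μ V)).asModule :=
    LinearEquiv.ofBijective (IntertwiningMap.equivLinearMapAsModule _ _
      (Representation.TensorProduct.comm (schurDual μ V) (schurDual ν V)).toIntertwiningMap)
      (TensorProduct.comm ℂ _ _).bijective
  let j : IntertwiningMap (youngFlattening T P).range.toRepresentation
      ((schurDual ν V).tprod (schurDual μ V)) :=
    ⟨(youngFlattening T P).range.toSubmodule.subtype, fun _ => rfl⟩
  refine nonempty_isotypicComponent_range_equiv (IntertwiningMap.equivLinearMapAsModule _ _ i) hi
    (IntertwiningMap.equivLinearMapAsModule _ _ p) hp e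
    (IntertwiningMap.equivLinearMapAsModule _ _ j) Subtype.val_injective ?_ M hdom hmid
  rintro _ ⟨x, rfl⟩
  exact ⟨⟨p (i x), x, rfl⟩, rfl⟩
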